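/- Let $i_0, j_0$ be positive integers, $n_0$ a non-negative integer, and let $t_{i,j}$ ($1\le i\le i_0$, $0\le j\le j_0$) be real numbers such that $\hat t_i := \sum_{j=0}^{j_0} t_{i,j} \ge 0$ for every $i$. Let $\lambda_1>0$ be a root of multiplicity one of the polynomial $$T(x) = x^{i_0} - \sum_{i=1}^{i_0} \hat t_i\, x^{i_0-i},$$ and suppose that all other complex roots of $T$ have modulus strictly less than $\lambda_1$. Let $(p_{n,k})_{n,k\in\mathbb Z}$ be non-negative real numbers such that $p_{n,k}=0$ whenever $n<0$ or $k<0$, only finitely many $p_{n,k}$ with $n<n_0$ are nonzero, $$p_{n,k} = \sum_{i=1}^{i_0}\sum_{j=0}^{j_0} t_{i,j}\,p_{n-i,k-j}\qquad\text{for all } n\ge n_0,\ k\in\mathbb Z,$$ and $\sum_{k=0}^\infty p_{n,k} = \Theta(\lambda_1^n)$ as $n\to\infty$. Put $$C_\mu = \frac{\sum_{i=1}^{i_0}\sum_{j=0}^{j_0} t_{i,j}\, j\,\lambda_1^{-i}}{\sum_{i=1}^{i_0}\sum_{j=0}^{j_0} t_{i,j}\, i\,\lambda_1^{-i}},\qquad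 C_\sigma = \frac{\sum_{i=1}^{i_0}\sum_{j=0}^{j_0} t_{i,j}\,\lambda_1^{-i}\,(j-C_\mu i)^2}{\sum_{i=1}^{i_0}\sum_{j=0}^{j_0} t_{i,j}\, i\,\lambda_1^{-i}},$$ and assume $C_\sigma>0$. For every $n$ with $\sum_{i\ge 0}p_{n,i}\ne 0$ (hence for all large $n$) let $X_n$ be a random variable with values in $\{0,1,2,\dots\}$ and $$\Pr[X_n=k] = \frac{p_{n,k}}{\sum_{i=0}^\infty p_{n,i}}\qquad (k\ge 0),$$ and let $\mu_n$ and $\sigma_n^2$ be its mean and variance. Then there exist constants $d_\mu,d_\sigma\in\mathbb R$ and $\gamma_\mu,\gamma_\sigma\in(0,1)$ such that, as $n\to\infty$, $$\mu_n = C_\mu n + d_\mu + O(\gamma_\mu^n),\qquad \sigma_n^2 = C_\sigma n + d_\sigma + O(\gamma_\sigma^n),$$ and $(X_n-\mu_n)/\sigma_n$ converges weakly to the standard normal distribution $N(0,1)$ as $n\to\infty$. -/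

import Mathlib

open MeasureTheory ProbabilityTheory Filter Asymptotics Polynomial

noncomputable section

namespace TwoDimRec

/-- A real polynomial `A` has the maximum root property with maximum root `r > 0`: `r` is a root of
multiplicity one, and every other complex root has modulus strictly less than `r`. -/
def HasMaxRoot (A : ℝ[X]) (r : ℝ) : Prop :=
  0 < r ∧ A.rootMultiplicity r = 1 ∧
    ∀ z : ℂ, aeval z A = 0 → z ≠ (r : ℂ) → ‖z‖ < r

/-- The collapsed coefficient `t̂ᵢ = ∑_{j=0}^{j₀} t_{i,j}`. -/
def tHat (j₀ : ℕ) (t : ℕ → ℕ → ℝ) (i : ℕ) : ℝ :=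
  ∑ j ∈ Finset.Icc 0 j₀, t i j

/-- The collapsed characteristic polynomial `T(x) = x^{i₀} - ∑_{i=1}^{i₀} t̂ᵢ x^{i₀-i}`. -/
def charPoly (i₀ j₀ : ℕ) (t : ℕ → ℕ → ℝ) : ℝ[X] :=
  X ^ i₀ - ∑ i ∈ Finset.Icc 1 i₀, C (tHat j₀ t i) * X ^ (i₀ - i)

/-- The total mass `∑_{k=0}^∞ p_{n,k}` of the `n`-th row. -/
def rowSum (p : ℤ → ℤ → ℝ) (n : ℕ) : ℝ :=
  ∑' k : ℕ, p n k

/-- The constant `C_μ` attached to the coefficients `t` and the root `r`. -/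
def Cmu (i₀ j₀ : ℕ) (t : ℕ → ℕ → ℝ) (r : ℝ) : ℝ :=
  (∑ i ∈ Finset.Icc 1 i₀, ∑ j ∈ Finset.Icc 0 j₀, t i j * (j : ℝ) / r ^ i) /
    (∑ i ∈ Finset.Icc 1 i₀, ∑ j ∈ Finset.Icc 0 j₀, t i j * (i : ℝ) / r ^ i)

/-- The constant `C_σ` attached to the coefficients `t` and the root `r`. -/
def Csigma (i₀ j₀ : ℕ) (t : ℕ → ℕ → ℝ) (r : ℝ) : ℝ :=
  (∑ i ∈ Finset.Icc 1 i₀, ∑ j ∈ Finset.Icc 0 j₀,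
      t i j / r ^ i * ((j : ℝ) - Cmu i₀ j₀ t r * (i : ℝ)) ^ 2) /
    (∑ i ∈ Finset.Icc 1 i₀, ∑ j ∈ Finset.Icc 0 j₀, t i j * (i : ℝ) / r ^ i)

end TwoDimRec

end

/-! Write `F n s = ∑ p n k * exp (k s)`. The recurrence becomes the scalar one `F n = ∑ t i j * exp
(j s) * F (n - i)`, whose dominant characteristic root near `s = 0` is `lam * exp (L s)` with `L`
analytic and `L 0 = 0` (`exists_log_root`, by the implicit function theorem). Implicit
differentiation identifies `L' 0` with `Cmu` and `L'' 0` with `Csigma`.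

The rescaled functions `v n s = lam⁻ⁿ * F n s * exp (-n L s)` satisfy a recurrence whose weights sum
to one for every `s` near `0`, so the characteristic polynomial has the factor `z - 1`. Dividing it
out leaves a recurrence for the increments `v (n+1) - v n`; at `s = 0` all its roots lie in the open
unit disc, and a spectral radius argument makes the decay uniform for `s` near `0`
(`exists_norm_increment_le`, `exists_geometric_rescaled`). Hence `v n` converges geometrically and
uniformly on a disc; by the `Θ` hypothesis the limit is nonzero at `0`.

Thus `F n` is nearly a power `(lam * exp (L s)) ^ n` times a fixed factor, and `quasiPower` applies:
Cauchy estimates at `0` give mean and variance, and characteristic functions at `i θ / σ n` give the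
normal limit. -/

namespace TwoDimRec

open scoped Topology


/-! ### Uniform exponential decay for linear recurrences with a parameter. -/

/-- If a continuous family of elements of a Banach algebra has spectral radius less than one at a
point, then its powers decay exponentially, uniformly near that point. -/
theorem exists_norm_pow_le {Y A : Type*} [TopologicalSpace Y] [NormedRing A] [NormedAlgebra ℂ A]
    [CompleteSpace A] {a : Y → A} {y : Y} (ha : ContinuousAt a y)
    (h : spectralRadius ℂ (a y) < 1) :
    ∃ K γ : ℝ, 0 < γ ∧ γ < 1 ∧ ∀ᶠ x in 𝓝 y, ∀ n : ℕ, ‖a x ^ n‖ ≤ K * γ ^ n := by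
  -- Gelfand's formula gives one power of norm below `1`; for this fixed `N` the bound `ρ` persists
  -- near `y`.
  obtain ⟨N, hN, hN0⟩ : ∃ N : ℕ, ‖a y ^ N‖ < 1 ∧ N ≠ 0 := by
    have h1 := ((spectrum.pow_nnnorm_pow_one_div_tendsto_nhds_spectralRadius (a y)).eventually
      (gt_mem_nhds h)).and (eventually_ne_atTop 0)
    obtain ⟨N, hN, hN0⟩ := h1.exists
    refine ⟨N, ?_, hN0⟩
    by_contra hcon
    have h2 : (1 : NNReal) ≤ ‖a y ^ N‖₊ := by exact_mod_cast not_lt.1 hcon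
    have h3 : (1 : ENNReal) ≤ (‖a y ^ N‖₊ : ENNReal) := by exact_mod_cast h2
    exact absurd (ENNReal.one_le_rpow h3 (by positivity)) (not_le.2 hN)
  obtain ⟨ρ, hρ, hρ1⟩ := exists_between hN
  have hρ0 : 0 < ρ := (norm_nonneg _).trans_lt hρ
  set γ : ℝ := ρ ^ ((N : ℝ)⁻¹) with hγ
  have hγN : γ ^ N = ρ := Real.rpow_inv_natCast_pow hρ0.le hN0
  have hγ0 : 0 < γ := Real.rpow_pos_of_pos hρ0 _
  have hγ1 : γ < 1 := Real.rpow_lt_one hρ0.le hρ1 (by positivity)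
  set M : ℝ := ‖a y‖ + 1 with hM
  have hM1 : 1 ≤ M := by have := norm_nonneg (a y); linarith
  -- Split `n` by division by `N`. The remainder costs at most `(‖1‖ + 1) * M ^ N`, where `‖1‖` need
  -- not be `1`; rounding `n / N` down costs at most `γ ^ N = ρ`.
  refine ⟨(‖(1 : A)‖ + 1) * M ^ N / ρ, γ, hγ0, hγ1, ?_⟩
  have e1 : ∀ᶠ x in 𝓝 y, ‖a x ^ N‖ < ρ := (ha.pow N).norm.eventually (gt_mem_nhds hρ)
  have e2 : ∀ᶠ x in 𝓝 y, ‖a x‖ < M := ha.norm.eventually (gt_mem_nhds (by rw [hM]; linarith))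
  filter_upwards [e1, e2] with x h1 h2 n
  have key : ∀ (b : A) (k : ℕ), ‖b ^ k‖ ≤ (‖(1 : A)‖ + 1) * ‖b‖ ^ k := by
    intro b k
    rcases Nat.eq_zero_or_pos k with rfl | hk
    · simp
    · have := norm_nonneg (1 : A)
      have h4 := norm_pow_le' b hk
      have h5 := pow_nonneg (norm_nonneg b) k
      nlinarith
  have hsplit : a x ^ n = (a x) ^ (n % N) * (a x ^ N) ^ (n / N) := by
    rw [← pow_mul, ← pow_add, Nat.mod_add_div]
  have hr : n % N ≤ N := (Nat.mod_lt _ (Nat.pos_of_ne_zero hN0)).le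
  have b1 : ‖a x ^ (n % N)‖ ≤ (‖(1 : A)‖ + 1) * M ^ N := by
    refine (key _ _).trans ?_
    gcongr
    calc ‖a x‖ ^ (n % N) ≤ M ^ (n % N) := by gcongr
      _ ≤ M ^ N := pow_le_pow_right₀ hM1 hr
  have b3 : ‖a x ^ n‖ ≤ (‖(1 : A)‖ + 1) * M ^ N * ρ ^ (n / N) := by
    rcases Nat.eq_zero_or_pos (n / N) with h0 | hq
    · rw [hsplit, h0, pow_zero, mul_one, pow_zero, mul_one]; exact b1
    · rw [hsplit]
      refine (norm_mul_le _ _).trans (mul_le_mul b1 ?_ (norm_nonneg _) (by positivity))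
      exact (norm_pow_le' _ hq).trans (by gcongr)
  refine b3.trans ?_
  rw [div_mul_eq_mul_div, le_div_iff₀ hρ0, mul_assoc]
  gcongr
  rw [← pow_succ, ← hγN, ← pow_mul]
  refine pow_le_pow_of_le_one hγ0.le hγ1.le ?_
  rw [mul_add, mul_one]
  have := Nat.mod_add_div n N
  omega

/-- The companion operator of a linear recurrence, as a continuous linear map. -/
noncomputable def companionCLM (m : ℕ) (c : Fin m → ℂ) : (Fin m → ℂ) →L[ℂ] (Fin m → ℂ) :=
  LinearMap.toContinuousLinearMap (LinearRecurrence.mk m c).tupleSucc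

theorem companionCLM_apply (m : ℕ) (c v : Fin m → ℂ) (i : Fin m) :
    companionCLM m c v i =
      if h : (i : ℕ) + 1 < m then v ⟨i + 1, h⟩ else ∑ j, c j * v j := rfl

theorem continuousAt_companionCLM {Y : Type*} [TopologicalSpace Y] {m : ℕ} {c : Y → Fin m → ℂ}
    {y : Y} (hc : ContinuousAt c y) : ContinuousAt (fun x => companionCLM m (c x)) y := by
  rw [continuousAt_clm_apply]
  intro v
  rw [continuousAt_pi]
  intro i
  simp only [companionCLM_apply]
  split_ifs
  · exact continuousAt_const
  · have : ∀ j, ContinuousAt (fun x => c x j) y := fun j => continuousAt_pi.1 hc j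
    fun_prop

/-- An eigenvector is a geometric progression with ratio `z`; its last coordinate gives the
characteristic equation. -/
theorem root_of_mem_spectrum_companionCLM {m : ℕ} {c : Fin m → ℂ} {z : ℂ}
    (hz : z ∈ spectrum ℂ (companionCLM m c)) : z ^ m = ∑ i, c i * z ^ (i : ℕ) := by
  have hz' : z ∈ spectrum ℂ (LinearRecurrence.mk m c).tupleSucc := by
    have e := AlgEquiv.spectrum_eq
      (Module.End.toContinuousLinearMap (𝕜 := ℂ) (Fin m → ℂ)) (LinearRecurrence.mk m c).tupleSucc
    rw [← e]
    exact hz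
  obtain ⟨v, hv⟩ := (Module.End.hasEigenvalue_iff_mem_spectrum.2 hz').exists_hasEigenvector
  have hv1 : ∀ i : Fin m, (if h : (i : ℕ) + 1 < m then v ⟨i + 1, h⟩ else ∑ j, c j * v j)
      = z * v i := fun i => congrFun hv.apply_eq_smul i
  have hm : 0 < m := by
    rcases Nat.eq_zero_or_pos m with rfl | h
    · exact absurd (Subsingleton.elim _ _) hv.2
    · exact h
  have hpow : ∀ (i : ℕ) (hi : i < m), v ⟨i, hi⟩ = z ^ i * v ⟨0, hm⟩ := by
    intro i
    induction i with
    | zero => intro hi; simp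
    | succ k ih =>
      intro hi
      have := hv1 ⟨k, by omega⟩
      rw [dif_pos hi, ih (by omega)] at this
      rw [this]; ring
  have h0 : v ⟨0, hm⟩ ≠ 0 := by
    intro h
    apply hv.2
    funext i
    rw [show i = ⟨i.1, i.2⟩ from rfl, hpow i.1 i.2, h]; simp
  have hlast := hv1 ⟨m - 1, by omega⟩
  rw [dif_neg (by simp only; omega), hpow (m - 1) (by omega)] at hlast
  have hs : ∑ j, c j * v j = (∑ j, c j * z ^ (j : ℕ)) * v ⟨0, hm⟩ := by
    rw [Finset.sum_mul]
    refine Finset.sum_congr rfl fun j _ => ?_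
    rw [show v j = v ⟨j.1, j.2⟩ from rfl, hpow j.1 j.2]; ring
  rw [hs, ← mul_assoc, ← pow_succ', Nat.sub_add_cancel hm] at hlast
  exact (mul_right_cancel₀ h0 hlast).symm

/-- A linear recurrence depending continuously on a parameter, all of whose characteristic roots at
a point lie in the open unit disc, has solutions that decay exponentially, uniformly near that
point. -/
theorem exists_norm_solution_le {Y : Type*} [TopologicalSpace Y] {m : ℕ} {c : Y → Fin m → ℂ}
    {y : Y} (hc : ContinuousAt c y)
    (hroot : ∀ z : ℂ, z ^ m = ∑ i, c y i * z ^ (i : ℕ) → ‖z‖ < 1) :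
    ∃ K γ : ℝ, 0 < γ ∧ γ < 1 ∧ ∀ᶠ x in 𝓝 y, ∀ u : ℕ → ℂ,
      (∀ n, u (n + m) = ∑ i, c x i * u (n + i)) →
      ∀ C : ℝ, 0 ≤ C → (∀ i < m, ‖u i‖ ≤ C) → ∀ n, ‖u n‖ ≤ K * C * γ ^ n := by
  -- Order zero forces `u = 0` and is treated apart because the spectral bound needs a nontrivial
  -- space. It does occur, for increments when `i₀ = 1`.
  rcases Nat.eq_zero_or_pos m with rfl | hm
  · refine ⟨0, 1 / 2, by norm_num, by norm_num, .of_forall fun x u hu C _ _ n => ?_⟩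
    have := hu n
    simp at this
    simp [this]
  have : NeZero m := ⟨hm.ne'⟩
  have hrad : spectralRadius ℂ (companionCLM m (c y)) < 1 := by
    have := spectrum.spectralRadius_lt_of_forall_lt (companionCLM m (c y)) (r := 1) ?_
    · simpa using this
    · intro z hz
      have := hroot z (root_of_mem_spectrum_companionCLM hz)
      exact_mod_cast this
  obtain ⟨K, γ, h0, h1, H⟩ := exists_norm_pow_le (continuousAt_companionCLM hc) hrad
  refine ⟨K, γ, h0, h1, ?_⟩
  filter_upwards [H] with x hx u hu C hC hCu n
  have hpow : ∀ n : ℕ, (companionCLM m (c x) ^ n) (fun i : Fin m => u i) =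
      fun i : Fin m => u (n + i) := by
    intro n
    induction n with
    | zero => simp
    | succ n ih =>
      rw [pow_succ', mul_apply_eq_comp, ih]
      funext i
      rw [companionCLM_apply]
      split_ifs with h
      · congr 1; simp only; omega
      · rw [← hu n]; congr 1; omega
  have h2 := congrFun (hpow n) ⟨0, hm⟩
  simp only [add_zero] at h2
  rw [← h2]
  calc _ ≤ ‖(companionCLM m (c x) ^ n) (fun i : Fin m => u i)‖ := norm_le_pi_norm _ _
    _ ≤ ‖companionCLM m (c x) ^ n‖ * ‖fun i : Fin m => u i‖ := ContinuousLinearMap.le_opNorm _ _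
    _ ≤ (K * γ ^ n) * C := by
      refine mul_le_mul (hx n) ?_ (norm_nonneg _) ((norm_nonneg _).trans (hx n))
      exact (pi_norm_le_iff_of_nonneg hC).2 fun i => hCu i i.2
    _ = K * C * γ ^ n := by ring

/-- Summation by parts. It serves both for solutions and, with `v i = z ^ i`, for splitting `z - 1`
off the characteristic polynomial. -/
theorem sum_range_partialSum_mul_sub (b v : ℕ → ℂ) (m : ℕ) :
    ∑ i ∈ Finset.range m, (∑ l ∈ Finset.range (i + 1), b l) * (v (i + 1) - v i) =
      (∑ l ∈ Finset.range m, b l) * v m - ∑ l ∈ Finset.range m, b l * v l := by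
  induction m with
  | zero => simp
  | succ m ih =>
    rw [Finset.sum_range_succ, ih, Finset.sum_range_succ b m,
      Finset.sum_range_succ (fun l => b l * v l)]
    ring

/-- A linear recurrence whose weights add up to one reduces to a recurrence of lower order for the
increments of the solution. -/
theorem increment_recurrence {b v : ℕ → ℂ} {m : ℕ} (hb : ∑ l ∈ Finset.range (m + 1), b l = 1)
    (hv : v (m + 1) = ∑ l ∈ Finset.range (m + 1), b l * v l) :
    v (m + 1) - v m =
      ∑ i : Fin m, (-∑ l ∈ Finset.range ((i : ℕ) + 1), b l) * (v (i + 1) - v i) := by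
  rw [Fin.sum_univ_eq_sum_range
    (fun i => (-∑ l ∈ Finset.range (i + 1), b l) * (v (i + 1) - v i)) m]
  simp only [neg_mul, Finset.sum_neg_distrib]
  rw [sum_range_partialSum_mul_sub, hv]
  rw [Finset.sum_range_succ] at hb ⊢
  linear_combination v m * hb

/-- A family of linear recurrences whose weights add up to one, are non-negative at a point and
have there no characteristic root other than `1` outside the open unit disc: the increments of the
solutions decay exponentially, uniformly near that point. -/
theorem exists_norm_increment_le {Y : Type*} [TopologicalSpace Y] {m : ℕ} {b : Y → ℕ → ℂ} {y : Y}
    (hc : ∀ l, ContinuousAt (fun x => b x l) y)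
    (hb : ∀ᶠ x in 𝓝 y, ∑ l ∈ Finset.range (m + 1), b x l = 1)
    (hpos : ∀ l ≤ m, ∃ r : ℝ, 0 ≤ r ∧ b y l = r)
    (hroot : ∀ z : ℂ, z ^ (m + 1) = ∑ l ∈ Finset.range (m + 1), b y l * z ^ l →
      z ≠ 1 → ‖z‖ < 1) :
    ∃ K γ : ℝ, 0 < γ ∧ γ < 1 ∧ ∀ᶠ x in 𝓝 y, ∀ v : ℕ → ℂ,
      (∀ n, v (n + (m + 1)) = ∑ l ∈ Finset.range (m + 1), b x l * v (n + l)) →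
      ∀ C : ℝ, 0 ≤ C → (∀ i < m, ‖v (i + 1) - v i‖ ≤ C) →
      ∀ n, ‖v (n + 1) - v n‖ ≤ K * C * γ ^ n := by
  have hsmall : ∀ z : ℂ, z ^ m = ∑ i : Fin m,
      (-∑ l ∈ Finset.range ((i : ℕ) + 1), b y l) * z ^ (i : ℕ) → ‖z‖ < 1 := by
    intro z hz
    have hz' : z ^ m + ∑ i ∈ Finset.range m, (∑ l ∈ Finset.range (i + 1), b y l) * z ^ i = 0 := by
      rw [hz, Fin.sum_univ_eq_sum_range
        (fun i => (-∑ l ∈ Finset.range (i + 1), b y l) * z ^ i) m]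
      simp [neg_mul]
    have hby := hb.self_of_nhds
    refine hroot z ?_ ?_
    · have h2 := sum_range_partialSum_mul_sub (b y) (fun i => z ^ i) m
      have h3 : ∑ i ∈ Finset.range m, (∑ l ∈ Finset.range (i + 1), b y l) * (z ^ (i + 1) - z ^ i)
          = (z - 1) * ∑ i ∈ Finset.range m, (∑ l ∈ Finset.range (i + 1), b y l) * z ^ i := by
        rw [Finset.mul_sum]
        exact Finset.sum_congr rfl fun i _ => by ring
      rw [h3] at h2
      rw [Finset.sum_range_succ] at hby ⊢
      linear_combination (z - 1) * hz' - h2 - z ^ m * hby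
    -- At `z = 1` the reduced equation says that `1` plus a sum of nonnegative partial sums
    -- vanishes.
    · rintro rfl
      simp only [one_pow, mul_one] at hz'
      have hre := congrArg Complex.re hz'
      have hnn : 0 ≤ (∑ i ∈ Finset.range m, ∑ l ∈ Finset.range (i + 1), b y l).re := by
        rw [Complex.re_sum]
        refine Finset.sum_nonneg fun i hi => ?_
        rw [Complex.re_sum]
        refine Finset.sum_nonneg fun l hl => ?_
        obtain ⟨r, hr, h⟩ := hpos l (by rw [Finset.mem_range] at hi hl; omega)
        rw [h]; simpa using hr
      rw [Complex.add_re, Complex.one_re, Complex.zero_re] at hre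
      linarith
  obtain ⟨K, γ, h0, h1, H⟩ := exists_norm_solution_le (m := m) (y := y)
    (c := fun x i => -∑ l ∈ Finset.range ((i : ℕ) + 1), b x l)
    (continuousAt_pi.2 fun i => (tendsto_finsetSum _ fun l _ => hc l).neg) hsmall
  refine ⟨K, γ, h0, h1, ?_⟩
  filter_upwards [H, hb] with x hx hbx v hv C hC hCv
  refine hx (fun n => v (n + 1) - v n) (fun n => ?_) C hC hCv
  have := increment_recurrence (v := fun i => v (n + i)) hbx (hv n)
  simpa only [add_assoc] using this


/-! ### The analytic exponent `L` and its derivatives. -/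

open scoped ContDiff in
/-- The equation `∑ w exp (β s - α y) = 1` is solved near the origin by an analytic function `y` of
`s`, as long as `∑ w = 1` and `∑ w α ≠ 0`. -/
theorem exists_analytic_exponent {ι : Type*} (S : Finset ι) (w α β : ι → ℂ)
    (hw : ∑ i ∈ S, w i = 1) (hA : ∑ i ∈ S, w i * α i ≠ 0) :
    ∃ L : ℂ → ℂ, AnalyticAt ℂ L 0 ∧ L 0 = 0 ∧
      ∀ᶠ s in 𝓝 0, ∑ i ∈ S, w i * Complex.exp (β i * s - α i * L s) = 1 := by
  set f : ℂ × ℂ → ℂ := fun q => ∑ i ∈ S, w i * Complex.exp (β i * q.1 - α i * q.2) with hf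
  have cdf : ContDiffAt ℂ ω f (0, 0) := by
    rw [hf]
    fun_prop
  have hd : HasDerivAt (fun y : ℂ => f (0, y)) (-∑ i ∈ S, w i * α i) 0 := by
    have : ∀ i ∈ S, HasDerivAt (fun y : ℂ => w i * Complex.exp (β i * 0 - α i * y))
        (-(w i * α i)) 0 := by
      intro i _
      have h := ((((hasDerivAt_id (0 : ℂ)).const_mul (α i)).const_sub (β i * 0)).cexp).const_mul
        (w i)
      convert! h using 1
      simp
    have := HasDerivAt.fun_sum this
    rwa [Finset.sum_neg_distrib] at this
  have hinr : fderiv ℂ f (0, 0) ∘L .inr ℂ ℂ ℂ =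
      (ContinuousLinearEquiv.unitsEquivAut ℂ (Units.mk0 (-∑ i ∈ S, w i * α i) (neg_ne_zero.2 hA)) :
        ℂ →L[ℂ] ℂ) := by
    ext
    have h1 : HasFDerivAt f (fderiv ℂ f (0, 0)) (0, 0) :=
      (cdf.differentiableAt (by simp)).hasFDerivAt
    have h2 : HasFDerivAt (fun y : ℂ => ((0 : ℂ), y)) (ContinuousLinearMap.inr ℂ ℂ ℂ) 0 :=
      hasFDerivAt_prodMk_right 0 0
    have h3 := (h1.comp (0 : ℂ) h2).hasDerivAt.unique hd
    rw [h3]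
    simp
  have hinv : (fderiv ℂ f (0, 0) ∘L .inr ℂ ℂ ℂ).IsInvertible := ⟨_, hinr.symm⟩
  refine ⟨cdf.implicitFunction (by simp) hinv, ?_, ?_, ?_⟩
  · exact (cdf.contDiffAt_implicitFunction (by simp) hinv).analyticAt
  · exact cdf.implicitFunction_apply_self (by simp) hinv
  · have h := cdf.eventually_apply_implicitFunction (by simp) hinv
    have h0 : f (0, 0) = 1 := by simp [hf, hw]
    filter_upwards [h] with s hs
    rw [← h0, ← hs]

/-- Differentiating the equation at `0` gives `∑ w (β - L' α) = 0`, and once more `∑ w ((β - L' α)²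
- α L'') = 0`. -/
theorem deriv_exponent {ι : Type*} {S : Finset ι} {w α β : ι → ℂ} {L : ℂ → ℂ}
    (hL : AnalyticAt ℂ L 0) (hL0 : L 0 = 0)
    (hA : ∑ i ∈ S, w i * α i ≠ 0)
    (h : ∀ᶠ s in 𝓝 0, ∑ i ∈ S, w i * Complex.exp (β i * s - α i * L s) = 1) :
    deriv L 0 = (∑ i ∈ S, w i * β i) / ∑ i ∈ S, w i * α i ∧
    deriv (deriv L) 0 =
      (∑ i ∈ S, w i * (β i - deriv L 0 * α i) ^ 2) / ∑ i ∈ S, w i * α i := by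
  have hder : ∀ᶠ s in 𝓝 (0 : ℂ),
      ∑ i ∈ S, w i * (Complex.exp (β i * s - α i * L s) * (β i - α i * deriv L s)) = 0 := by
    filter_upwards [h.eventually_nhds, hL.eventually_analyticAt] with s hs hLs
    have h1 : HasDerivAt (fun s => ∑ i ∈ S, w i * Complex.exp (β i * s - α i * L s))
        (∑ i ∈ S, w i * (Complex.exp (β i * s - α i * L s) * (β i - α i * deriv L s))) s := by
      refine HasDerivAt.fun_sum fun i _ => ?_
      have := (((hasDerivAt_id s).const_mul (β i)).sub
        (hLs.differentiableAt.hasDerivAt.const_mul (α i))).cexp.const_mul (w i)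
      simpa using this
    exact h1.unique ((hasDerivAt_const s (1 : ℂ)).congr_of_eventuallyEq hs)
  have e1 := hder.self_of_nhds
  simp only [hL0, mul_zero, sub_zero, Complex.exp_zero, one_mul] at e1
  have d1 : deriv L 0 = (∑ i ∈ S, w i * β i) / ∑ i ∈ S, w i * α i := by
    rw [eq_div_iff hA, Finset.mul_sum]
    rw [← sub_eq_zero, ← Finset.sum_sub_distrib, ← neg_eq_zero, ← Finset.sum_neg_distrib]
    exact (Finset.sum_congr rfl fun i _ => by ring).trans e1
  refine ⟨d1, ?_⟩
  have h2 : HasDerivAt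
      (fun s => ∑ i ∈ S, w i * (Complex.exp (β i * s - α i * L s) * (β i - α i * deriv L s)))
      (∑ i ∈ S, w i * ((β i - deriv L 0 * α i) ^ 2 - α i * deriv (deriv L) 0)) 0 := by
    refine HasDerivAt.fun_sum fun i _ => ?_
    have hA1 := (((hasDerivAt_id (0 : ℂ)).const_mul (β i)).sub
        (hL.differentiableAt.hasDerivAt.const_mul (α i))).cexp
    have hA2 := (hL.deriv.differentiableAt.hasDerivAt.const_mul (α i)).const_sub (β i)
    have := (hA1.mul hA2).const_mul (w i)
    convert! this using 1
    simp [hL0]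
    ring_nf
    simp
  have e2 := h2.unique ((hasDerivAt_const (0 : ℂ) (0 : ℂ)).congr_of_eventuallyEq hder)
  rw [eq_div_iff hA, Finset.mul_sum, ← sub_eq_zero, ← Finset.sum_sub_distrib, ← neg_eq_zero,
    ← Finset.sum_neg_distrib]
  exact (Finset.sum_congr rfl fun i _ => by ring).trans e2

/-! ### Geometric convergence of sequences of analytic functions. -/

theorem exists_norm_sub_le_of_geometric {f : ℕ → ℂ} {K γ : ℝ} {N : ℕ} (hγ : γ < 1)
    (h : ∀ n ≥ N, ‖f (n + 1) - f n‖ ≤ K * γ ^ n) :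
    ∃ c, ∀ n ≥ N, ‖f n - c‖ ≤ K * γ ^ n / (1 - γ) := by
  have h' : ∀ n, dist (f (n + N)) (f (n + 1 + N)) ≤ (K * γ ^ N) * γ ^ n := by
    intro n
    rw [dist_comm, dist_eq_norm, mul_assoc, ← pow_add, add_comm N n,
      show n + 1 + N = n + N + 1 by ring]
    exact h (n + N) (by omega)
  obtain ⟨c, hc⟩ := cauchySeq_tendsto_of_complete (cauchySeq_of_le_geometric γ _ hγ h')
  refine ⟨c, fun n hn => ?_⟩
  have := dist_le_of_le_geometric_of_tendsto γ _ hγ h' hc (n - N)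
  rwa [Nat.sub_add_cancel hn, mul_assoc, ← pow_add, Nat.add_sub_cancel' hn, dist_eq_norm] at this

theorem exists_isBigO_sub_of_geometric {f : ℕ → ℂ} {K γ : ℝ} {N : ℕ} (hγ0 : 0 < γ) (hγ : γ < 1)
    (h : ∀ n ≥ N, ‖f (n + 1) - f n‖ ≤ K * γ ^ n) :
    ∃ c, (fun n => f n - c) =O[atTop] fun n => γ ^ n := by
  obtain ⟨c, hc⟩ := exists_norm_sub_le_of_geometric hγ h
  refine ⟨c, IsBigO.of_bound (K / (1 - γ)) ?_⟩
  filter_upwards [eventually_ge_atTop N] with n hn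
  rw [Real.norm_of_nonneg (by positivity), div_mul_eq_mul_div]
  exact hc n hn

/-- The derivatives at the centre of a disc of a sequence of analytic functions that converges
geometrically on the disc converge geometrically. -/
theorem exists_isBigO_iteratedDeriv_sub {v : ℕ → ℂ → ℂ} {K γ r : ℝ} {N : ℕ} (hr : 0 < r)
    (hγ0 : 0 < γ) (hγ : γ < 1)
    (hv : ∀ n, DifferentiableOn ℂ (v n) (Metric.ball 0 r))
    (h : ∀ n ≥ N, ∀ s ∈ Metric.ball (0 : ℂ) r, ‖v (n + 1) s - v n s‖ ≤ K * γ ^ n) (k : ℕ) :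
    ∃ c, (fun n => iteratedDeriv k (v n) 0 - c) =O[atTop] fun n => γ ^ n := by
  -- This is Cauchy's estimate for the increment on the circle of radius `r / 2`.
  refine exists_isBigO_sub_of_geometric (K := k.factorial * K / (r / 2) ^ k) (N := N) hγ0 hγ ?_
  intro n hn
  have hcd : ∀ n, ContDiffAt ℂ k (v n) 0 := fun n =>
    ((hv n).analyticAt (Metric.ball_mem_nhds 0 hr)).contDiffAt
  rw [← iteratedDeriv_sub (hcd (n + 1)) (hcd n)]
  have hsub : Metric.closedBall (0 : ℂ) (r / 2) ⊆ Metric.ball 0 r :=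
    Metric.closedBall_subset_ball (by linarith)
  have := Complex.norm_iteratedDeriv_le_of_forall_mem_sphere_norm_le (f := v (n + 1) - v n)
    (c := 0) (R := r / 2) (C := K * γ ^ n) k (by positivity) ?_ ?_
  · refine this.trans (le_of_eq ?_)
    ring
  · exact (((hv (n + 1)).sub (hv n)).mono hsub).diffContOnCl_ball subset_rfl
  · intro z hz
    exact h n hn z (hsub (Metric.sphere_subset_closedBall hz))

/-- The limit is uniform, hence continuous, so the evaluation point may move with `n`.
Characteristic functions are evaluated at such moving points. -/
theorem exists_tendsto_of_geometric {v : ℕ → ℂ → ℂ} {K γ r : ℝ} {N : ℕ} (hr : 0 < r)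
    (hγ0 : 0 < γ) (hγ : γ < 1)
    (hv : ∀ n, DifferentiableOn ℂ (v n) (Metric.ball 0 r))
    (h : ∀ n ≥ N, ∀ s ∈ Metric.ball (0 : ℂ) r, ‖v (n + 1) s - v n s‖ ≤ K * γ ^ n) :
    ∃ c, ∀ s : ℕ → ℂ, Tendsto s atTop (𝓝 0) → Tendsto (fun n => v n (s n)) atTop (𝓝 c) := by
  have hex : ∀ s : ℂ, ∃ c, s ∈ Metric.ball (0 : ℂ) r →
      ∀ n ≥ N, ‖v n s - c‖ ≤ K * γ ^ n / (1 - γ) := by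
    intro s
    by_cases hs : s ∈ Metric.ball (0 : ℂ) r
    · obtain ⟨c, hc⟩ := exists_norm_sub_le_of_geometric (f := fun n => v n s) hγ
        (fun n hn => h n hn s hs)
      exact ⟨c, fun _ => hc⟩
    · exact ⟨0, fun h => absurd h hs⟩
  choose c hc using hex
  have hlim : Tendsto (fun n => K * γ ^ n / (1 - γ)) atTop (𝓝 0) := by
    simpa using ((tendsto_pow_atTop_nhds_zero_of_lt_one hγ0.le hγ).const_mul K).div_const (1 - γ)
  have hunif : TendstoUniformlyOn v c atTop (Metric.ball 0 r) := by
    rw [Metric.tendstoUniformlyOn_iff]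
    intro ε hε
    filter_upwards [hlim.eventually (gt_mem_nhds hε), eventually_ge_atTop N] with n h1 h2 s hs
    rw [dist_comm, dist_eq_norm]
    exact (hc s hs n h2).trans_lt h1
  have hcont : ContinuousOn c (Metric.ball 0 r) :=
    hunif.continuousOn (Frequently.of_forall fun n => (hv n).continuousOn)
  refine ⟨c 0, fun s hs => ?_⟩
  have h0 : (0 : ℂ) ∈ Metric.ball (0 : ℂ) r := Metric.mem_ball_self hr
  refine hunif.tendsto_comp (hcont 0 h0) (tendsto_nhdsWithin_iff.2 ⟨hs, ?_⟩)
  exact hs.eventually (Metric.ball_mem_nhds 0 hr)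

theorem isBigO_mul_sub_mul {f g : ℕ → ℂ} {c d : ℂ} {h : ℕ → ℝ} (hh : Tendsto h atTop (𝓝 0))
    (hf : (fun n => f n - c) =O[atTop] h) (hg : (fun n => g n - d) =O[atTop] h) :
    (fun n => f n * g n - c * d) =O[atTop] h := by
  have hgt : Tendsto g atTop (𝓝 d) := by
    simpa using (hg.trans_tendsto hh).add_const d
  have h1 : (fun n => (f n - c) * g n) =O[atTop] fun n => h n * (1 : ℝ) :=
    hf.mul (hgt.isBigO_one ℝ)
  simp only [mul_one] at h1
  refine (h1.add (hg.const_mul_left c)).congr_left fun n => by ring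

theorem isBigO_inv_sub_inv {f : ℕ → ℂ} {c : ℂ} {h : ℕ → ℝ} (hh : Tendsto h atTop (𝓝 0))
    (hc : c ≠ 0) (hf : (fun n => f n - c) =O[atTop] h) :
    (fun n => (f n)⁻¹ - c⁻¹) =O[atTop] h := by
  have hft : Tendsto f atTop (𝓝 c) := by
    simpa using (hf.trans_tendsto hh).add_const c
  have h1 : (fun n => (f n - c) * (-(f n)⁻¹ * c⁻¹)) =O[atTop] fun n => h n * (1 : ℝ) :=
    hf.mul ((((hft.inv₀ hc).neg).mul_const c⁻¹).isBigO_one ℝ)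
  simp only [mul_one] at h1
  refine h1.congr' ?_ EventuallyEq.rfl
  filter_upwards [hft.eventually_ne hc] with n hn
  field_simp
  ring


/-! ### Moments of laws with finite support. -/

section FiniteLaw

variable {Ω : Type*} [MeasurableSpace Ω] {P : Measure Ω} [IsProbabilityMeasure P] {X : Ω → ℕ}
  {a : ℕ → ℝ} {D : ℕ} {R : ℝ}

theorem ae_eq_sum_indicator {E : Type*} [AddCommMonoid E] (hD : ∀ k ≥ D, a k = 0)
    (hX : ∀ k, P.real {ω | X ω = k} = a k / R) (g : ℕ → E) :
    (fun ω => g (X ω)) =ᵐ[P]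
      fun ω => ∑ k ∈ Finset.range D, {ω | X ω = k}.indicator (fun _ => g k) ω := by
  have h0 : ∀ᵐ ω ∂P, ∀ k, D ≤ k → X ω ≠ k := by
    rw [ae_all_iff]
    intro k
    by_cases hk : D ≤ k
    · have : P {ω | X ω = k} = 0 := by
        rw [← measureReal_eq_zero_iff, hX k, hD k hk, zero_div]
      filter_upwards [measure_eq_zero_iff_ae_notMem.1 this] with ω hω _ using hω
    · exact .of_forall fun ω h => absurd h hk
  filter_upwards [h0] with ω hω
  have hlt : X ω < D := by
    by_contra h
    exact hω (X ω) (not_lt.1 h) rfl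
  rw [Finset.sum_eq_single_of_mem (X ω) (Finset.mem_range.2 hlt)]
  · simp
  · intro b _ hb
    exact Set.indicator_of_notMem (fun h => hb (Eq.symm h)) _

theorem integrable_comp_of_finite_law {E : Type*} [NormedAddCommGroup E] (hXm : Measurable X)
    (hD : ∀ k ≥ D, a k = 0) (hX : ∀ k, P.real {ω | X ω = k} = a k / R) (g : ℕ → E) :
    Integrable (fun ω => g (X ω)) P := by
  refine (integrable_congr (ae_eq_sum_indicator hD hX g)).2 (integrable_finsetSum _ fun k _ => ?_)
  exact (integrable_const _).indicator (hXm (measurableSet_singleton k))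

theorem integral_comp_of_finite_law {E : Type*} [NormedAddCommGroup E] [NormedSpace ℝ E]
    [CompleteSpace E] (hXm : Measurable X)
    (hD : ∀ k ≥ D, a k = 0) (hX : ∀ k, P.real {ω | X ω = k} = a k / R) (g : ℕ → E) :
    ∫ ω, g (X ω) ∂P = ∑ k ∈ Finset.range D, (a k / R) • g k := by
  have hms : ∀ k, MeasurableSet {ω | X ω = k} := fun k => hXm (measurableSet_singleton k)
  rw [integral_congr_ae (ae_eq_sum_indicator hD hX g), integral_finsetSum]
  · refine Finset.sum_congr rfl fun k _ => ?_
    rw [integral_indicator_const _ (hms k), hX k]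
  · exact fun k _ => (integrable_const _).indicator (hms k)

theorem variance_of_finite_law (hXm : Measurable X)
    (hD : ∀ k ≥ D, a k = 0) (hX : ∀ k, P.real {ω | X ω = k} = a k / R) :
    variance (fun ω => (X ω : ℝ)) P =
      ∑ k ∈ Finset.range D, (a k / R) * (k : ℝ) ^ 2 - (∫ ω, (X ω : ℝ) ∂P) ^ 2 := by
  rw [variance_eq_sub]
  · congr 1
    have := integral_comp_of_finite_law hXm hD hX (fun k => (k : ℝ) ^ 2)
    simpa only [Pi.pow_apply, smul_eq_mul] using this
  · rw [memLp_two_iff_integrable_sq]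
    · exact integrable_comp_of_finite_law hXm hD hX (fun k => (k : ℝ) ^ 2)
    · exact (measurable_from_top.comp hXm).aestronglyMeasurable

end FiniteLaw

/-! ### Exponential polynomials and expansions at the origin. -/

/-- The exponential polynomial `s ↦ ∑_{k<D} a k exp (k s)`. -/
noncomputable def expPoly (a : ℕ → ℝ) (D : ℕ) (s : ℂ) : ℂ :=
  ∑ k ∈ Finset.range D, (a k : ℂ) * Complex.exp (k * s)

theorem expPoly_zero (a : ℕ → ℝ) (D : ℕ) :
    expPoly a D 0 = ((∑ k ∈ Finset.range D, a k : ℝ) : ℂ) := by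
  simp [expPoly]

theorem hasDerivAt_expPoly (a : ℕ → ℝ) (D : ℕ) (s : ℂ) :
    HasDerivAt (expPoly a D) (expPoly (fun k => a k * k) D s) s := by
  refine HasDerivAt.fun_sum fun k _ => ?_
  have := (((hasDerivAt_id s).const_mul (k : ℂ)).cexp).const_mul (a k : ℂ)
  convert! this using 1
  simp
  ring

theorem deriv_expPoly (a : ℕ → ℝ) (D : ℕ) : deriv (expPoly a D) = expPoly (fun k => a k * k) D :=
  funext fun s => (hasDerivAt_expPoly a D s).deriv

theorem differentiable_expPoly (a : ℕ → ℝ) (D : ℕ) : Differentiable ℂ (expPoly a D) :=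
  fun s => (hasDerivAt_expPoly a D s).differentiableAt

/-- With `F` an unnormalised moment generating function, this makes `v' / v` at `0` the mean minus
`n L'`, and `v'' / v - (v' / v)²` the variance minus `n L''`. -/
theorem deriv_mul_exp_neg {F L v : ℂ → ℂ} {A n : ℂ} (hF : Differentiable ℂ F)
    (hL : AnalyticAt ℂ L 0) (hL0 : L 0 = 0)
    (hv : ∀ s, v s = A * F s * Complex.exp (-(n * L s))) :
    deriv v 0 = A * (deriv F 0 - n * deriv L 0 * F 0) ∧
    deriv (deriv v) 0 = A * (deriv (deriv F) 0 - 2 * (n * deriv L 0) * deriv F 0 +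
      (n * deriv L 0) ^ 2 * F 0 - n * deriv (deriv L) 0 * F 0) := by
  have hFa : ∀ s, AnalyticAt ℂ F s := fun s => hF.analyticAt s
  have h1 : ∀ᶠ s in 𝓝 (0 : ℂ), HasDerivAt v
      (A * (Complex.exp (-(n * L s)) * (deriv F s - n * deriv L s * F s))) s := by
    filter_upwards [hL.eventually_analyticAt] with s hs
    have e1 := (hs.differentiableAt.hasDerivAt.const_mul n).neg.cexp
    have e2 := ((hF s).hasDerivAt.const_mul A).mul e1
    rw [show v = fun s => A * F s * Complex.exp (-(n * L s)) from funext hv]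
    convert! e2 using 1
    simp only [Pi.neg_apply]
    ring
  have h2 : deriv v =ᶠ[𝓝 0]
      fun s => A * (Complex.exp (-(n * L s)) * (deriv F s - n * deriv L s * F s)) :=
    h1.mono fun s hs => hs.deriv
  refine ⟨by simpa [hL0] using h1.self_of_nhds.deriv, ?_⟩
  have e1 := (hL.differentiableAt.hasDerivAt.const_mul n).neg.cexp
  have e3 := ((hL.deriv.differentiableAt.hasDerivAt.const_mul n).mul
    (hFa 0).differentiableAt.hasDerivAt)
  have e4 := (e1.mul ((hFa 0).deriv.differentiableAt.hasDerivAt.sub e3)).const_mul A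
  rw [h2.deriv_eq]
  refine e4.deriv.trans ?_
  simp only [Pi.neg_apply, Pi.sub_apply, Pi.mul_apply, hL0, mul_zero, neg_zero, Complex.exp_zero]
  ring

theorem isLittleO_sub_taylor_two {L : ℂ → ℂ} (hL : AnalyticAt ℂ L 0) (hL0 : L 0 = 0) :
    (fun s => L s - (deriv L 0 * s + deriv (deriv L) 0 / 2 * s ^ 2)) =o[𝓝 0] fun s => s ^ 2 := by
  have h := hL.hasFPowerSeriesAt.isBigO_sub_partialSum_pow 3
  have h3 : (fun s : ℂ => ‖s‖ ^ 3) =o[𝓝 0] fun s => s ^ 2 := by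
    have : (fun s : ℂ => s ^ 3) =o[𝓝 0] fun s => s ^ 2 := isLittleO_pow_pow (by norm_num)
    simpa [norm_pow] using this.norm_left
  refine (h.trans_isLittleO h3).congr_left fun s => ?_
  simp [FormalMultilinearSeries.partialSum, Finset.sum_range_succ, hL0, iteratedDeriv_succ]
  ring


/-! ### The quasi-power theorem. -/

theorem isBigO_re_sub {f : ℕ → ℝ} {g : ℕ → ℂ} {c : ℂ} {h : ℕ → ℝ}
    (hg : (fun n => g n - c) =O[atTop] h) (hfg : ∀ᶠ n in atTop, g n = (f n : ℂ)) :
    (fun n => f n - c.re) =O[atTop] h := by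
  refine (IsBigO.of_bound 1 ?_).trans hg
  filter_upwards [hfg] with n hn
  rw [hn, one_mul, Real.norm_eq_abs]
  simpa using Complex.abs_re_le_norm ((f n : ℂ) - c)

/-- Limit of the characteristic functions in the quasi-power theorem. -/
theorem tendsto_exp_quasiPower {L : ℂ → ℂ} (hL : AnalyticAt ℂ L 0) (hL0 : L 0 = 0) {m q : ℝ}
    (hm : deriv L 0 = m) (hq : deriv (deriv L) 0 = q) (hq0 : 0 < q) {μ V : ℕ → ℝ} {d : ℝ}
    (hμ : Tendsto (fun n : ℕ => μ n - m * n) atTop (𝓝 d))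
    (hV : Tendsto (fun n : ℕ => V n / n) atTop (𝓝 q)) (θ : ℝ) :
    Tendsto (fun n : ℕ => ((θ / Real.sqrt (V n) : ℝ) : ℂ) * Complex.I) atTop (𝓝 0) ∧
    Tendsto (fun n : ℕ => Complex.exp (n * L ((θ / Real.sqrt (V n) : ℝ) * Complex.I) -
      (θ / Real.sqrt (V n) : ℝ) * Complex.I * μ n)) atTop (𝓝 (Complex.exp (-(θ ^ 2 / 2 : ℝ)))) := by
  have hVtop : Tendsto V atTop atTop := by
    have := hV.pos_mul_atTop hq0 (tendsto_natCast_atTop_atTop (R := ℝ))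
    refine this.congr' ?_
    filter_upwards [eventually_ne_atTop 0] with n hn
    field_simp
  set x : ℕ → ℝ := fun n => θ / Real.sqrt (V n) with hx
  have hx0 : Tendsto x atTop (𝓝 0) :=
    (Real.tendsto_sqrt_atTop.comp hVtop).const_div_atTop θ
  set s : ℕ → ℂ := fun n => (x n : ℂ) * Complex.I with hs
  have hs0 : Tendsto s atTop (𝓝 0) := by
    have : Tendsto (fun n => (x n : ℂ)) atTop (𝓝 ((0 : ℝ) : ℂ)) :=
      (Complex.continuous_ofReal.tendsto 0).comp hx0
    simpa using this.mul_const Complex.I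
  have hns : Tendsto (fun n : ℕ => (n : ℂ) * s n ^ 2) atTop (𝓝 (-(θ ^ 2 / q : ℝ))) := by
    have h1 : Tendsto (fun n : ℕ => -(θ ^ 2 / (V n / n))) atTop (𝓝 (-(θ ^ 2 / q))) :=
      (tendsto_const_nhds.div hV hq0.ne').neg
    have h2 : Tendsto (fun n : ℕ => ((-(θ ^ 2 / (V n / n)) : ℝ) : ℂ)) atTop
        (𝓝 ((-(θ ^ 2 / q) : ℝ) : ℂ)) := (Complex.continuous_ofReal.tendsto _).comp h1
    rw [Complex.ofReal_neg] at h2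
    refine h2.congr' ?_
    filter_upwards [hVtop.eventually_gt_atTop 0, eventually_ne_atTop 0] with n hn hn0
    have : x n ^ 2 = θ ^ 2 / V n := by rw [hx, div_pow, Real.sq_sqrt hn.le]
    rw [hs, mul_pow, Complex.I_sq, ← Complex.ofReal_pow, this]
    push_cast
    have hVc : (V n : ℂ) ≠ 0 := by exact_mod_cast hn.ne'
    field_simp
  refine ⟨hs0, (Complex.continuous_exp.tendsto _).comp ?_⟩
  -- Decompose `n L(s) - s μ = n (L(s) - m s - q s² / 2) + (q / 2) n s² - s (μ - m n)`. As `n s²`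
  -- converges to `-θ² / q`, only the middle term survives.
  have hlit := (isLittleO_sub_taylor_two hL hL0).comp_tendsto hs0
  have h1 : Tendsto (fun n : ℕ => (n : ℂ) * (L (s n) - (m * s n + q / 2 * s n ^ 2))) atTop
      (𝓝 0) := by
    have h2 : (fun n : ℕ => (n : ℂ) * (L (s n) - (m * s n + q / 2 * s n ^ 2))) =o[atTop]
        fun n : ℕ => (n : ℂ) * s n ^ 2 := by
      refine (isBigO_refl (fun n : ℕ => (n : ℂ)) atTop).mul_isLittleO ?_
      simpa only [hm, hq, Function.comp_def] using hlit
    have h3 := h2.trans_isBigO (hns.isBigO_one ℂ)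
    exact (isLittleO_one_iff ℂ).1 h3
  have h4 : Tendsto (fun n : ℕ => s n * ((μ n - m * n : ℝ) : ℂ)) atTop (𝓝 0) := by
    simpa using hs0.mul ((Complex.continuous_ofReal.tendsto _).comp hμ)
  have h5 := (h1.add (hns.const_mul (q / 2 : ℂ))).sub h4
  have hqc : (q : ℂ) ≠ 0 := by exact_mod_cast hq0.ne'
  have h6 : (0 : ℂ) + (q / 2 : ℂ) * (-(θ ^ 2 / q : ℝ)) - 0 = -(θ ^ 2 / 2 : ℝ) := by
    push_cast
    field_simp
    ring
  rw [h6] at h5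
  refine h5.congr fun n => ?_
  change _ = (n : ℂ) * L (s n) - s n * μ n
  push_cast
  ring

/-- **Quasi-power theorem**: if, near the origin, the moment generating functions of a sequence of
`ℕ`-valued random variables of finite support are proportional to `v n s * exp (n * L s)` with `v n`
converging geometrically, then mean and variance are affine in `n` up to an exponentially small
error, and the normalised variables converge in distribution to the standard normal law. -/
theorem quasiPower {Ω : ℕ → Type*} [∀ n, MeasurableSpace (Ω n)]
    (P : ∀ n, Measure (Ω n)) [∀ n, IsProbabilityMeasure (P n)]
    (X : ∀ n, Ω n → ℕ) (hXm : ∀ n, Measurable (X n))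
    (a : ℕ → ℕ → ℝ) (D : ℕ → ℕ) (hD : ∀ n, ∀ k ≥ D n, a n k = 0)
    (hX : ∀ n, ∑ k ∈ Finset.range (D n), a n k ≠ 0 →
      ∀ k, (P n).real {ω | X n ω = k} = a n k / ∑ k ∈ Finset.range (D n), a n k)
    {L : ℂ → ℂ} (hL : AnalyticAt ℂ L 0) (hL0 : L 0 = 0) {m q : ℝ}
    (hm : deriv L 0 = m) (hq : deriv (deriv L) 0 = q) (hq0 : 0 < q)
    {A : ℕ → ℂ} {v : ℕ → ℂ → ℂ}
    (hv : ∀ n s, v n s = A n * expPoly (a n) (D n) s * Complex.exp (-(n * L s)))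
    {K γ r : ℝ} {N : ℕ} (hr : 0 < r) (hγ0 : 0 < γ) (hγ : γ < 1)
    (hvd : ∀ n, DifferentiableOn ℂ (v n) (Metric.ball 0 r))
    (hgeom : ∀ n ≥ N, ∀ s ∈ Metric.ball (0 : ℂ) r, ‖v (n + 1) s - v n s‖ ≤ K * γ ^ n)
    (hnz : ¬ Tendsto (fun n => v n 0) atTop (𝓝 0)) :
    (∃ d : ℝ, (fun n : ℕ => (∫ ω, (X n ω : ℝ) ∂(P n)) - (m * n + d)) =O[atTop]
      fun n : ℕ => γ ^ n) ∧
    (∃ d : ℝ, (fun n : ℕ => variance (fun ω => (X n ω : ℝ)) (P n) - (q * n + d)) =O[atTop]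
      fun n : ℕ => γ ^ n) ∧
    TendstoInDistribution
      (fun (n : ℕ) (ω : Ω n) => ((X n ω : ℝ) - ∫ ω', (X n ω' : ℝ) ∂(P n)) /
        Real.sqrt (variance (fun ω' => (X n ω' : ℝ)) (P n)))
      atTop (id : ℝ → ℝ) P (gaussianReal 0 1) := by
  set R : ℕ → ℝ := fun n => ∑ k ∈ Finset.range (D n), a n k with hR
  set μ : ℕ → ℝ := fun n => ∫ ω, (X n ω : ℝ) ∂(P n) with hμ
  set V : ℕ → ℝ := fun n => variance (fun ω => (X n ω : ℝ)) (P n) with hV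
  have hγt : Tendsto (fun n : ℕ => γ ^ n) atTop (𝓝 0) :=
    tendsto_pow_atTop_nhds_zero_of_lt_one hγ0.le hγ
  obtain ⟨c, hc⟩ := exists_tendsto_of_geometric hr hγ0 hγ hvd hgeom
  obtain ⟨c₀, hc₀⟩ := exists_isBigO_iteratedDeriv_sub hr hγ0 hγ hvd hgeom 0
  obtain ⟨c₁, hc₁⟩ := exists_isBigO_iteratedDeriv_sub hr hγ0 hγ hvd hgeom 1
  obtain ⟨c₂, hc₂⟩ := exists_isBigO_iteratedDeriv_sub hr hγ0 hγ hvd hgeom 2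
  simp only [iteratedDeriv_zero] at hc₀
  simp only [iteratedDeriv_one] at hc₁
  simp only [iteratedDeriv_succ, iteratedDeriv_zero] at hc₂
  have hv0 : Tendsto (fun n => v n 0) atTop (𝓝 c₀) := by
    simpa using (hc₀.trans_tendsto hγt).add_const c₀
  have hcc : c = c₀ := tendsto_nhds_unique (hc (fun _ => 0) tendsto_const_nhds) hv0
  subst hcc
  -- A nonzero limit makes `A n` and `R n` nonzero for large `n`, which is all the asymptotic
  -- statements need.
  have hc0 : c ≠ 0 := fun h => hnz (h ▸ hv0)
  have hne : ∀ᶠ n in atTop, v n 0 ≠ 0 := hv0.eventually_ne hc0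
  have hvR : ∀ n, v n 0 = A n * R n := fun n => by
    rw [hv, hL0, expPoly_zero, mul_zero, neg_zero, Complex.exp_zero, mul_one]
  have hARne : ∀ᶠ n in atTop, A n ≠ 0 ∧ R n ≠ 0 := by
    filter_upwards [hne] with n hn
    rw [hvR] at hn
    exact ⟨left_ne_zero_of_mul hn, by exact_mod_cast right_ne_zero_of_mul hn⟩
  have hmean : ∀ n, R n ≠ 0 → (μ n : ℂ) * R n = deriv (expPoly (a n) (D n)) 0 := by
    intro n hn
    have h1 := integral_comp_of_finite_law (hXm n) (hD n) (hX n hn) (fun k => (k : ℝ))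
    rw [deriv_expPoly, expPoly_zero, ← Complex.ofReal_mul, hμ]
    simp only [h1, smul_eq_mul, Finset.sum_mul]
    congr 1
    refine Finset.sum_congr rfl fun k _ => ?_
    change a n k / R n * k * R n = _
    field_simp
  have hvar : ∀ n, R n ≠ 0 → ((V n : ℂ) + μ n ^ 2) * R n =
      deriv (deriv (expPoly (a n) (D n))) 0 := by
    intro n hn
    have h1 := variance_of_finite_law (hXm n) (hD n) (hX n hn)
    have h2 : V n + μ n ^ 2 = ∑ k ∈ Finset.range (D n), (a n k / R n) * (k : ℝ) ^ 2 := by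
      rw [hV, hμ]; linarith
    rw [deriv_expPoly, deriv_expPoly, expPoly_zero, ← Complex.ofReal_pow, ← Complex.ofReal_add,
      ← Complex.ofReal_mul, h2, Finset.sum_mul]
    congr 1
    refine Finset.sum_congr rfl fun k _ => ?_
    field_simp
  have hder := fun n => deriv_mul_exp_neg (differentiable_expPoly (a n) (D n)) hL hL0 (hv n)
  have hinv := isBigO_inv_sub_inv hγt hc0 hc₀
  have hB1 := isBigO_mul_sub_mul hγt hc₁ hinv
  have hB2 := isBigO_mul_sub_mul hγt hc₂ hinv
  have hB3 := (hB2.sub (isBigO_mul_sub_mul hγt hB1 hB1)).congr_left (f₂ := fun n =>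
    (deriv (deriv (v n)) 0 * (v n 0)⁻¹ -
      deriv (v n) 0 * (v n 0)⁻¹ * (deriv (v n) 0 * (v n 0)⁻¹)) -
      (c₂ * c⁻¹ - c₁ * c⁻¹ * (c₁ * c⁻¹))) (fun n => by ring)
  have hmeanO := isBigO_re_sub (f := fun n => μ n - m * n) hB1 (by
    filter_upwards [hARne] with n hn
    have hAc := hn.1
    have hRc : (R n : ℂ) ≠ 0 := by exact_mod_cast hn.2
    rw [(hder n).1, hvR, ← hmean n hn.2, expPoly_zero, hm]
    change A n * (μ n * R n - n * m * R n) * (A n * R n)⁻¹ = _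
    push_cast
    field_simp)
  have hvarO := isBigO_re_sub (f := fun n => V n - q * n) hB3 (by
    filter_upwards [hARne] with n hn
    have hAc := hn.1
    have hRc : (R n : ℂ) ≠ 0 := by exact_mod_cast hn.2
    rw [(hder n).1, (hder n).2, hvR, ← hmean n hn.2, ← hvar n hn.2, expPoly_zero, hm, hq]
    change A n * ((V n + μ n ^ 2) * R n - 2 * (n * m) * (μ n * R n) + (n * m) ^ 2 * R n -
      n * q * R n) * (A n * R n)⁻¹ - A n * (μ n * R n - n * m * R n) * (A n * R n)⁻¹ *
      (A n * (μ n * R n - n * m * R n) * (A n * R n)⁻¹) = _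
    push_cast
    field_simp
    ring)
  refine ⟨⟨(c₁ * c⁻¹).re, hmeanO.congr_left fun n => by ring⟩,
    ⟨(c₂ * c⁻¹ - c₁ * c⁻¹ * (c₁ * c⁻¹)).re, hvarO.congr_left fun n => by ring⟩, ?_⟩
  have hμt : Tendsto (fun n : ℕ => μ n - m * n) atTop (𝓝 (c₁ * c⁻¹).re) := by
    simpa using (hmeanO.trans_tendsto hγt).add_const (c₁ * c⁻¹).re
  have hVt : Tendsto (fun n : ℕ => V n / n) atTop (𝓝 q) := by
    have h1 : Tendsto (fun n : ℕ => V n - q * n) atTop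
        (𝓝 (c₂ * c⁻¹ - c₁ * c⁻¹ * (c₁ * c⁻¹)).re) := by
      simpa using (hvarO.trans_tendsto hγt).add_const (c₂ * c⁻¹ - c₁ * c⁻¹ * (c₁ * c⁻¹)).re
    have h2 := (h1.div_atTop (tendsto_natCast_atTop_atTop (R := ℝ))).add_const q
    rw [zero_add] at h2
    refine h2.congr' ?_
    filter_upwards [eventually_ne_atTop 0] with n hn
    field_simp
    ring
  have hYm : ∀ n, Measurable (fun ω : Ω n => ((X n ω : ℝ) - μ n) / Real.sqrt (V n)) := fun n =>
    ((measurable_from_top (f := fun k : ℕ => (k : ℝ))).comp (hXm n)).sub_const _ |>.div_const _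
  refine ⟨fun n => (hYm n).aemeasurable, aemeasurable_id, ?_⟩
  refine ProbabilityMeasure.tendsto_iff_tendsto_charFun.2 fun θ => ?_
  simp only [ProbabilityMeasure.coe_mk, Measure.map_id]
  rw [charFun_gaussianReal]
  obtain ⟨hs0, hexp⟩ := tendsto_exp_quasiPower hL hL0 hm hq hq0 hμt hVt θ
  -- For large `n` the characteristic function is `exp (n L(s) - s μ) * v n s / v n 0` at `s = i θ /
  -- √V`; the quotient of `v`'s tends to `1`.
  have hlim := hexp.mul ((hc _ hs0).mul (hv0.inv₀ hc0))
  rw [mul_inv_cancel₀ hc0, mul_one] at hlim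
  have hval : Complex.exp (θ * (0 : ℝ) * Complex.I - ((1 : NNReal) : ℝ) * θ ^ 2 / 2) =
      Complex.exp (-(θ ^ 2 / 2 : ℝ)) := by
    congr 1
    push_cast
    ring
  rw [hval]
  refine hlim.congr' ?_
  filter_upwards [hARne] with n hn
  have hAc := hn.1
  have hRc : (R n : ℂ) ≠ 0 := by exact_mod_cast hn.2
  rw [charFun_apply_real, integral_map (hYm n).aemeasurable
    (by fun_prop)]
  have h1 := integral_comp_of_finite_law (hXm n) (hD n) (hX n hn.2)
    (fun k => Complex.exp (θ * (((k : ℝ) - μ n) / Real.sqrt (V n) : ℝ) * Complex.I))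
  rw [h1, hvR, hv]
  set x : ℝ := θ / Real.sqrt (V n) with hx
  have h2 : ∀ k : ℕ, Complex.exp (θ * (((k : ℝ) - μ n) / Real.sqrt (V n) : ℝ) * Complex.I) =
      Complex.exp (k * (x * Complex.I)) * Complex.exp (-(x * Complex.I * μ n)) := by
    intro k
    rw [← Complex.exp_add]
    congr 1
    rw [hx]
    push_cast
    ring
  simp only [h2, expPoly]
  have h3 : ∑ k ∈ Finset.range (D n), (a n k / ∑ k ∈ Finset.range (D n), a n k) •
      (Complex.exp (k * (x * Complex.I)) * Complex.exp (-(x * Complex.I * μ n))) =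
      (∑ k ∈ Finset.range (D n), (a n k : ℂ) * Complex.exp (k * (x * Complex.I))) / R n *
        Complex.exp (-(x * Complex.I * μ n)) := by
    rw [Finset.sum_div, Finset.sum_mul]
    refine Finset.sum_congr rfl fun k _ => ?_
    change (a n k / R n) • _ = _
    rw [Complex.real_smul]
    push_cast
    ring
  rw [h3, sub_eq_add_neg, Complex.exp_add, Complex.exp_neg (n * _)]
  have he := Complex.exp_ne_zero (n * L (x * Complex.I))
  field_simp


/-! ### The recurrence for row generating functions and its characteristic polynomial. -/

theorem exists_row_support_bound {i₀ j₀ n₀ : ℕ} {t : ℕ → ℕ → ℝ} {p : ℤ → ℤ → ℝ}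
    (hrec : ∀ n k : ℤ, (n₀ : ℤ) ≤ n →
      p n k = ∑ i ∈ Finset.Icc 1 i₀, ∑ j ∈ Finset.Icc 0 j₀, t i j * p (n - (i : ℤ)) (k - (j : ℤ)))
    (hp_zero : ∀ n k : ℤ, n < 0 ∨ k < 0 → p n k = 0)
    (hp_fin : {q : ℤ × ℤ | q.1 < (n₀ : ℤ) ∧ p q.1 q.2 ≠ 0}.Finite) :
    ∃ D : ℕ → ℕ, ∀ (n : ℕ) (k : ℤ), (D n : ℤ) ≤ k → p n k = 0 := by
  obtain ⟨B, hB⟩ := (hp_fin.image Prod.snd).bddAbove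
  -- `B` bounds the support of the initial rows; going back `i ≥ 1` rows shifts `k` by at most `j₀ ≤
  -- j₀ * i`.
  refine ⟨fun n => B.toNat + j₀ * n + 1, fun n => ?_⟩
  induction n using Nat.strong_induction_on with
  | _ n ih =>
    intro k hk
    push_cast at hk
    rcases lt_or_ge (n : ℤ) n₀ with hn | hn
    · by_contra hne
      have h1 : k ≤ B := hB ⟨(n, k), ⟨hn, hne⟩, rfl⟩
      have h2 := Int.self_le_toNat B
      have h3 : (0 : ℤ) ≤ j₀ * n := by positivity
      omega
    · rw [hrec n k hn]
      refine Finset.sum_eq_zero fun i hi => Finset.sum_eq_zero fun j hj => ?_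
      rw [Finset.mem_Icc] at hi hj
      rcases le_or_gt i n with hin | hin
      · obtain ⟨l, rfl⟩ := Nat.exists_eq_add_of_le' hin
        rw [show ((l + i : ℕ) : ℤ) - i = (l : ℤ) by push_cast; ring,
          ih l (by omega) (k - j), mul_zero]
        have h4 : (j₀ : ℤ) * 1 ≤ j₀ * i := by
          have : (1 : ℤ) ≤ i := by exact_mod_cast hi.1
          gcongr
        have h5 : (j : ℤ) ≤ j₀ := by exact_mod_cast hj.2
        push_cast at hk ⊢
        rw [mul_add] at hk
        linarith
      · rw [hp_zero _ _ (Or.inl (by omega)), mul_zero]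

/-- Summing over all of `ℤ` makes the shift `k ↦ k - j` a bijection, without boundary terms. -/
theorem hasSum_expPoly {f : ℤ → ℝ} {D : ℕ} (hneg : ∀ k < 0, f k = 0)
    (hD : ∀ k : ℤ, (D : ℤ) ≤ k → f k = 0) (s : ℂ) :
    HasSum (fun k : ℤ => (f k : ℂ) * Complex.exp (k * s))
      (expPoly (fun k : ℕ => f k) D s) := by
  have h : expPoly (fun k : ℕ => f k) D s =
      ∑ k ∈ (Finset.range D).map Nat.castEmbedding, (f k : ℂ) * Complex.exp (k * s) := by
    rw [Finset.sum_map]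
    simp [expPoly]
  rw [h]
  refine hasSum_sum_of_ne_finset_zero fun k hk => ?_
  rcases lt_or_ge k 0 with h0 | h0
  · simp [hneg k h0]
  · rcases lt_or_ge k D with h1 | h1
    · refine absurd ?_ hk
      rw [Finset.mem_map]
      exact ⟨k.toNat, by rw [Finset.mem_range]; omega, by simp [h0]⟩
    · simp [hD k h1]

theorem expPoly_recurrence {i₀ j₀ n₀ : ℕ} {t : ℕ → ℕ → ℝ} {p : ℤ → ℤ → ℝ}
    (hrec : ∀ n k : ℤ, (n₀ : ℤ) ≤ n →
      p n k = ∑ i ∈ Finset.Icc 1 i₀, ∑ j ∈ Finset.Icc 0 j₀, t i j * p (n - (i : ℤ)) (k - (j : ℤ)))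
    (hp_zero : ∀ n k : ℤ, n < 0 ∨ k < 0 → p n k = 0)
    {D : ℕ → ℕ} (hD : ∀ (n : ℕ) (k : ℤ), (D n : ℤ) ≤ k → p n k = 0)
    {n : ℕ} (hn : n₀ ≤ n) (hi₀ : i₀ ≤ n) (s : ℂ) :
    expPoly (fun k : ℕ => p n k) (D n) s =
      ∑ i ∈ Finset.Icc 1 i₀, ∑ j ∈ Finset.Icc 0 j₀, (t i j : ℂ) * Complex.exp (j * s) *
        expPoly (fun k : ℕ => p (n - i : ℕ) k) (D (n - i)) s := by
  have h1 := hasSum_expPoly (fun k hk => hp_zero n k (Or.inr hk)) (hD n) s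
  refine h1.unique ?_
  have h2 : ∀ i ∈ Finset.Icc 1 i₀, ∀ j ∈ Finset.Icc 0 j₀,
      HasSum (fun k : ℤ => (t i j : ℂ) * Complex.exp (j * s) *
        ((p (n - i : ℕ) (k - j) : ℂ) * Complex.exp ((k - j : ℤ) * s)))
        ((t i j : ℂ) * Complex.exp (j * s) *
          expPoly (fun k : ℕ => p (n - i : ℕ) k) (D (n - i)) s) := by
    intro i _ j _
    have h3 := hasSum_expPoly (fun k hk => hp_zero (n - i : ℕ) k (Or.inr hk)) (hD (n - i)) s
    exact ((Equiv.subRight (j : ℤ)).hasSum_iff.2 h3).mul_left _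
  refine (hasSum_sum fun i hi => hasSum_sum fun j hj => h2 i hi j hj).congr_fun ?_
  intro k
  rw [hrec n k (by exact_mod_cast hn)]
  push_cast
  rw [Finset.sum_mul]
  refine Finset.sum_congr rfl fun i hi => ?_
  rw [Finset.sum_mul]
  refine Finset.sum_congr rfl fun j _ => ?_
  rw [Nat.cast_sub ((Finset.mem_Icc.1 hi).2.trans hi₀),
    show (k : ℂ) * s = j * s + (k - j) * s by ring, Complex.exp_add]
  ring

theorem rowSum_eq_sum_range {p : ℤ → ℤ → ℝ} {D : ℕ → ℕ}
    (hD : ∀ (n : ℕ) (k : ℤ), (D n : ℤ) ≤ k → p n k = 0) (n : ℕ) :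
    rowSum p n = ∑ k ∈ Finset.range (D n), p n k := by
  refine tsum_eq_sum fun k hk => hD n k ?_
  rw [Finset.mem_range, not_lt] at hk
  exact_mod_cast hk

theorem sum_Icc_one_eq_sum_range {E : Type*} [AddCommMonoid E] (m : ℕ) (f : ℕ → E) :
    ∑ i ∈ Finset.Icc 1 (m + 1), f i = ∑ l ∈ Finset.range (m + 1), f (m + 1 - l) := by
  refine Finset.sum_nbij' (fun i => m + 1 - i) (fun l => m + 1 - l) ?_ ?_ ?_ ?_ ?_
  · intro i hi; simp only [Finset.mem_Icc, Finset.mem_range] at *; omega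
  · intro i hi; simp only [Finset.mem_Icc, Finset.mem_range] at *; omega
  · intro i hi; simp only [Finset.mem_Icc] at *; omega
  · intro i hi; simp only [Finset.mem_range] at *; omega
  · intro i hi
    simp only [Finset.mem_Icc] at hi
    congr 1
    omega

theorem aeval_charPoly (i₀ j₀ : ℕ) (t : ℕ → ℕ → ℝ) (z : ℂ) :
    aeval z (charPoly i₀ j₀ t) =
      z ^ i₀ - ∑ i ∈ Finset.Icc 1 i₀, (tHat j₀ t i : ℂ) * z ^ (i₀ - i) := by
  simp [charPoly]

theorem HasMaxRoot.sum_tHat_div_pow {i₀ j₀ : ℕ} {t : ℕ → ℕ → ℝ} {r : ℝ}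
    (hT : HasMaxRoot (charPoly i₀ j₀ t) r) :
    ∑ i ∈ Finset.Icc 1 i₀, tHat j₀ t i / r ^ i = 1 := by
  obtain ⟨hr, hmul, -⟩ := hT
  have hroot : (charPoly i₀ j₀ t).IsRoot r :=
    (Polynomial.rootMultiplicity_pos'.1 (by rw [hmul]; exact one_pos)).2
  have h1 : r ^ i₀ - ∑ i ∈ Finset.Icc 1 i₀, tHat j₀ t i * r ^ (i₀ - i) = 0 := by
    have := hroot.eq_zero
    simpa [charPoly, eval_finsetSum] using this
  have hri : r ^ i₀ ≠ 0 := (pow_pos hr _).ne'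
  have h2 : (∑ i ∈ Finset.Icc 1 i₀, tHat j₀ t i / r ^ i) * r ^ i₀ = 1 * r ^ i₀ := by
    rw [Finset.sum_mul, one_mul]
    refine (Finset.sum_congr rfl fun i hi => ?_).trans (sub_eq_zero.1 h1).symm
    rw [← Nat.sub_add_cancel (Finset.mem_Icc.1 hi).2, pow_add, Nat.add_sub_cancel]
    have := (pow_pos hr i).ne'
    field_simp
  exact mul_right_cancel₀ hri h2

/-- The substitution `x = r z` carries the maximum root to `1` and the other roots into the open
unit disc. -/
theorem HasMaxRoot.norm_lt_one {m j₀ : ℕ} {t : ℕ → ℕ → ℝ} {r : ℝ}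
    (hT : HasMaxRoot (charPoly (m + 1) j₀ t) r) {z : ℂ}
    (hz : z ^ (m + 1) = ∑ l ∈ Finset.range (m + 1),
      ((tHat j₀ t (m + 1 - l) / r ^ (m + 1 - l) : ℝ) : ℂ) * z ^ l) (hz1 : z ≠ 1) :
    ‖z‖ < 1 := by
  have hr := hT.1
  have hrc : (r : ℂ) ≠ 0 := by exact_mod_cast hr.ne'
  have h := hT.2.2 (r * z) ?_ ?_
  · rw [norm_mul, Complex.norm_real, Real.norm_of_nonneg hr.le] at h
    nlinarith
  · rw [aeval_charPoly, sum_Icc_one_eq_sum_range, mul_pow, hz, Finset.mul_sum, sub_eq_zero]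
    refine Finset.sum_congr rfl fun l hl => ?_
    rw [Finset.mem_range] at hl
    have hsub : m + 1 - (m + 1 - l) = l := by omega
    rw [hsub, mul_pow]
    have hsplit : (r : ℂ) ^ (m + 1) = r ^ (m + 1 - l) * r ^ l := by
      rw [← pow_add]; congr 1; omega
    rw [hsplit]
    push_cast
    field_simp
  · intro h
    apply hz1
    have : (r : ℂ) * z = r * 1 := by rw [h, mul_one]
    exact mul_left_cancel₀ hrc this

/-- Since `i ≥ 1`, the sum dominates `∑ tHat / r ^ i = 1`. It is both the denominator of the
constants and the derivative that must not vanish in the implicit function theorem. -/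
theorem HasMaxRoot.sum_mul_div_pow_pos {i₀ j₀ : ℕ} {t : ℕ → ℕ → ℝ} {r : ℝ}
    (ht : ∀ i ∈ Finset.Icc 1 i₀, 0 ≤ tHat j₀ t i)
    (hT : HasMaxRoot (charPoly i₀ j₀ t) r) :
    0 < ∑ i ∈ Finset.Icc 1 i₀, ∑ j ∈ Finset.Icc 0 j₀, t i j * (i : ℝ) / r ^ i := by
  refine one_pos.trans_le ?_
  rw [← hT.sum_tHat_div_pow]
  refine Finset.sum_le_sum fun i hi => ?_
  have h1 : ∑ j ∈ Finset.Icc 0 j₀, t i j * (i : ℝ) / r ^ i = tHat j₀ t i / r ^ i * i := by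
    rw [tHat, Finset.sum_div, Finset.sum_mul]
    exact Finset.sum_congr rfl fun j _ => by ring
  rw [h1]
  refine le_mul_of_one_le_right (div_nonneg (ht i hi) (pow_pos hT.1 i).le) ?_
  exact_mod_cast (Finset.mem_Icc.1 hi).1


/-! ### The dominant root and the rescaled rows. -/

/-- The logarithm `L` of the normalised dominant root of the characteristic equation in which `t i j`
is twisted by `exp (j s)`, with its first two derivatives at the origin. -/
theorem exists_log_root {i₀ j₀ : ℕ} {t : ℕ → ℕ → ℝ} {r : ℝ}
    (ht : ∀ i ∈ Finset.Icc 1 i₀, 0 ≤ tHat j₀ t i) (hT : HasMaxRoot (charPoly i₀ j₀ t) r) :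
    ∃ L : ℂ → ℂ, AnalyticAt ℂ L 0 ∧ L 0 = 0 ∧
      (∀ᶠ s in 𝓝 0, ∑ i ∈ Finset.Icc 1 i₀, ∑ j ∈ Finset.Icc 0 j₀,
        (t i j / r ^ i : ℂ) * Complex.exp (j * s - i * L s) = 1) ∧
      deriv L 0 = Cmu i₀ j₀ t r ∧ deriv (deriv L) 0 = Csigma i₀ j₀ t r := by
  set S := Finset.Icc 1 i₀ ×ˢ Finset.Icc 0 j₀ with hS
  set w : ℕ × ℕ → ℂ := fun q => t q.1 q.2 / r ^ q.1 with hw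
  have hA : ∑ q ∈ S, w q * (q.1 : ℂ) = ((∑ i ∈ Finset.Icc 1 i₀, ∑ j ∈ Finset.Icc 0 j₀,
      t i j * (i : ℝ) / r ^ i : ℝ) : ℂ) := by
    rw [hS, Finset.sum_product]
    push_cast
    exact Finset.sum_congr rfl fun i _ => Finset.sum_congr rfl fun j _ => by
      rw [hw, div_mul_eq_mul_div]
  have hA0 : ∑ q ∈ S, w q * (q.1 : ℂ) ≠ 0 := by
    rw [hA]
    exact_mod_cast (hT.sum_mul_div_pow_pos ht).ne'
  have hw1 : ∑ q ∈ S, w q = 1 := by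
    rw [hS, Finset.sum_product]
    have := congrArg (fun x : ℝ => (x : ℂ)) hT.sum_tHat_div_pow
    simp only [Complex.ofReal_one] at this
    rw [← this]
    push_cast
    refine Finset.sum_congr rfl fun i _ => ?_
    simp only [hw, tHat, ← Finset.sum_div]
    push_cast
    rfl
  obtain ⟨L, hL, hL0, hLe⟩ := exists_analytic_exponent S w (fun q => (q.1 : ℂ))
    (fun q => (q.2 : ℂ)) hw1 hA0
  obtain ⟨hd1, hd2⟩ := deriv_exponent hL hL0 hA0 hLe
  have hB : ∑ q ∈ S, w q * (q.2 : ℂ) = ((∑ i ∈ Finset.Icc 1 i₀, ∑ j ∈ Finset.Icc 0 j₀,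
      t i j * (j : ℝ) / r ^ i : ℝ) : ℂ) := by
    rw [hS, Finset.sum_product]
    push_cast
    exact Finset.sum_congr rfl fun i _ => Finset.sum_congr rfl fun j _ => by
      rw [hw, div_mul_eq_mul_div]
  have hm : deriv L 0 = Cmu i₀ j₀ t r := by
    rw [hd1, hA, hB, Cmu, Complex.ofReal_div]
  refine ⟨L, hL, hL0, ?_, hm, ?_⟩
  · filter_upwards [hLe] with s hs
    rwa [hS, Finset.sum_product] at hs
  · rw [hd2, hA, hm, Csigma, Complex.ofReal_div]
    congr 1
    rw [hS, Finset.sum_product]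
    push_cast
    rfl

/-- The rescaled row generating functions converge geometrically near the origin. -/
theorem exists_geometric_rescaled {m j₀ n₀ : ℕ} {t : ℕ → ℕ → ℝ} {r : ℝ}
    (ht : ∀ i ∈ Finset.Icc 1 (m + 1), 0 ≤ tHat j₀ t i)
    (hT : HasMaxRoot (charPoly (m + 1) j₀ t) r) {p : ℤ → ℤ → ℝ}
    (hrec : ∀ n k : ℤ, (n₀ : ℤ) ≤ n → p n k =
      ∑ i ∈ Finset.Icc 1 (m + 1), ∑ j ∈ Finset.Icc 0 j₀, t i j * p (n - (i : ℤ)) (k - (j : ℤ)))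
    (hp_zero : ∀ n k : ℤ, n < 0 ∨ k < 0 → p n k = 0)
    {D : ℕ → ℕ} (hD : ∀ (n : ℕ) (k : ℤ), (D n : ℤ) ≤ k → p n k = 0)
    {L : ℂ → ℂ} (hL : AnalyticAt ℂ L 0) (hL0 : L 0 = 0)
    (hLe : ∀ᶠ s in 𝓝 0, ∑ i ∈ Finset.Icc 1 (m + 1), ∑ j ∈ Finset.Icc 0 j₀,
        (t i j / r ^ i : ℂ) * Complex.exp (j * s - i * L s) = 1)
    {v : ℕ → ℂ → ℂ} (hv : ∀ n s, v n s = ((r : ℂ) ^ n)⁻¹ *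
      expPoly (fun k : ℕ => p n k) (D n) s * Complex.exp (-(n * L s))) :
    ∃ K γ ε : ℝ, 0 < ε ∧ 0 < γ ∧ γ < 1 ∧
      (∀ n, DifferentiableOn ℂ (v n) (Metric.ball 0 ε)) ∧
      ∀ n ≥ n₀, ∀ s ∈ Metric.ball (0 : ℂ) ε, ‖v (n + 1) s - v n s‖ ≤ K * γ ^ n := by
  have hrc : (r : ℂ) ≠ 0 := by exact_mod_cast hT.1.ne'
  -- `B s i` is the weight of lag `i` in the recurrence for `v`; the equation defining `L` says that
  -- these weights sum to one.
  set B : ℂ → ℕ → ℂ := fun s i => ∑ j ∈ Finset.Icc 0 j₀,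
    (t i j / r ^ i : ℂ) * Complex.exp (j * s - i * L s) with hB
  have hB0 : ∀ i, B 0 i = ((tHat j₀ t i / r ^ i : ℝ) : ℂ) := by
    intro i
    simp only [hB, tHat, hL0, mul_zero, sub_zero, Complex.exp_zero, mul_one, ← Finset.sum_div]
    push_cast
    rfl
  have hLc : ContinuousAt L 0 := hL.continuousAt
  have hvrec : ∀ s n, v (n₀ + (n + (m + 1))) s =
      ∑ l ∈ Finset.range (m + 1), B s (m + 1 - l) * v (n₀ + (n + l)) s := by
    intro s n
    rw [hv, expPoly_recurrence hrec hp_zero hD (by omega) (by omega), sum_Icc_one_eq_sum_range,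
      Finset.mul_sum, Finset.sum_mul]
    refine Finset.sum_congr rfl fun l hl => ?_
    rw [Finset.mem_range] at hl
    have hsub : n₀ + (n + (m + 1)) - (m + 1 - l) = n₀ + (n + l) := by omega
    rw [hsub, hv, hB, Finset.mul_sum, Finset.sum_mul, Finset.sum_mul]
    refine Finset.sum_congr rfl fun j _ => ?_
    obtain ⟨i, hi⟩ : ∃ i, i = m + 1 - l := ⟨_, rfl⟩
    have hN : n₀ + (n + (m + 1)) = n₀ + (n + l) + i := by omega
    rw [← hi, hN, pow_add, Complex.exp_sub]
    push_cast
    rw [show -(((n₀ : ℂ) + (n + l) + i) * L s) = -(((n₀ : ℂ) + (n + l)) * L s) + -(i * L s) by ring,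
      Complex.exp_add, Complex.exp_neg (i * L s)]
    have := Complex.exp_ne_zero (i * L s)
    field_simp
  obtain ⟨K, γ, hγ0, hγ1, H⟩ := exists_norm_increment_le (m := m) (y := (0 : ℂ))
    (b := fun s l => B s (m + 1 - l)) (by intro l; simp only [hB]; fun_prop)
    (by
      filter_upwards [hLe] with s hs
      rw [← hs, sum_Icc_one_eq_sum_range])
    (fun l hl => ⟨_, div_nonneg (ht (m + 1 - l) (by rw [Finset.mem_Icc]; omega))
      (pow_pos hT.1 _).le, hB0 _⟩)
    (fun z hz hz1 => hT.norm_lt_one (by simpa only [hB0] using hz) hz1)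
  have hvc : ∀ n, ContinuousAt (v n) 0 := by
    intro n
    rw [show v n = _ from funext (hv n)]
    have := (differentiable_expPoly (fun k : ℕ => p n k) (D n)).continuous
    fun_prop
  -- By continuity each initial increment stays near `0` below its value at `0` plus one; the sum
  -- bounds them all.
  set C : ℝ := ∑ i ∈ Finset.range m, (‖v (n₀ + (i + 1)) 0 - v (n₀ + i) 0‖ + 1) with hC
  have hinit : ∀ᶠ s in 𝓝 (0 : ℂ), ∀ i < m, ‖v (n₀ + (i + 1)) s - v (n₀ + i) s‖ ≤ C := by
    have h1 : ∀ᶠ s in 𝓝 (0 : ℂ), ∀ i ∈ Finset.range m,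
        ‖v (n₀ + (i + 1)) s - v (n₀ + i) s‖ <
          ‖v (n₀ + (i + 1)) 0 - v (n₀ + i) 0‖ + 1 := by
      rw [Filter.eventually_all_finset]
      intro i _
      exact ((hvc _).sub (hvc _)).norm.eventually (gt_mem_nhds (lt_add_one _))
    filter_upwards [h1] with s hs i hi
    refine (hs i (Finset.mem_range.2 hi)).le.trans ?_
    exact Finset.single_le_sum (f := fun i => ‖v (n₀ + (i + 1)) 0 - v (n₀ + i) 0‖ + 1)
      (fun i _ => by positivity) (Finset.mem_range.2 hi)
  have hC0 : 0 ≤ C := Finset.sum_nonneg fun i _ => by positivity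
  obtain ⟨ε, hε, hball⟩ := Metric.eventually_nhds_iff_ball.1
    (H.and (hinit.and hL.eventually_analyticAt))
  -- The decay is counted from row `n₀`; the factor `(γ ^ n₀)⁻¹` undoes this shift.
  refine ⟨K * C * (γ ^ n₀)⁻¹, γ, ε, hε, hγ0, hγ1, fun n s hs => ?_, fun n hn s hs => ?_⟩
  · have h1 : DifferentiableAt ℂ L s := (hball s hs).2.2.differentiableAt
    have h2 := differentiable_expPoly (fun k : ℕ => p n k) (D n) s
    rw [show v n = _ from funext (hv n)]
    exact DifferentiableAt.differentiableWithinAt (by fun_prop)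
  · obtain ⟨l, rfl⟩ := Nat.exists_eq_add_of_le hn
    have h := (hball s hs).1 (fun n => v (n₀ + n) s) (hvrec s) C hC0 (hball s hs).2.1 l
    refine h.trans (le_of_eq ?_)
    have := (pow_pos hγ0 n₀).ne'
    rw [pow_add]
    field_simp

end TwoDimRec

/-! ### The limit theorem. -/

theorem theorem2p6
    (i₀ j₀ n₀ : ℕ) (hi₀ : 0 < i₀) (hj₀ : 0 < j₀)
    (t : ℕ → ℕ → ℝ)
    (ht : ∀ i ∈ Finset.Icc 1 i₀, 0 ≤ TwoDimRec.tHat j₀ t i)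
    (lam : ℝ) (hT : TwoDimRec.HasMaxRoot (TwoDimRec.charPoly i₀ j₀ t) lam)
    (p : ℤ → ℤ → ℝ)
    (hrec : ∀ n k : ℤ, (n₀ : ℤ) ≤ n →
      p n k = ∑ i ∈ Finset.Icc 1 i₀, ∑ j ∈ Finset.Icc 0 j₀, t i j * p (n - (i : ℤ)) (k - (j : ℤ)))
    (hp_nonneg : ∀ n k : ℤ, 0 ≤ p n k)
    (hp_zero : ∀ n k : ℤ, n < 0 ∨ k < 0 → p n k = 0)
    (hp_fin : {q : ℤ × ℤ | q.1 < (n₀ : ℤ) ∧ p q.1 q.2 ≠ 0}.Finite)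
    (hp_theta : (fun n : ℕ => TwoDimRec.rowSum p n) =Θ[atTop] fun n : ℕ => lam ^ n)
    (hC : 0 < TwoDimRec.Csigma i₀ j₀ t lam)
    -- `X n` is any random variable whose mass function is `k ↦ p n k / ∑ i, p n i`;
    -- nothing is required for the finitely many `n` at which the row vanishes
    {Ω : ℕ → Type*} [∀ n, MeasurableSpace (Ω n)]
    (P : ∀ n, Measure (Ω n)) [∀ n, IsProbabilityMeasure (P n)]
    (X : ∀ n, Ω n → ℕ) (hX_meas : ∀ n, Measurable (X n))
    (hX : ∀ n : ℕ, TwoDimRec.rowSum p n ≠ 0 →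
      ∀ k : ℕ, (P n).real {ω | X n ω = k} = p n k / TwoDimRec.rowSum p n) :
    (∃ dμ γμ : ℝ, 0 < γμ ∧ γμ < 1 ∧
      (fun n : ℕ => (∫ ω, (X n ω : ℝ) ∂(P n)) -
        (TwoDimRec.Cmu i₀ j₀ t lam * (n : ℝ) + dμ)) =O[atTop] fun n : ℕ => γμ ^ n) ∧
    (∃ dσ γσ : ℝ, 0 < γσ ∧ γσ < 1 ∧
      (fun n : ℕ => variance (fun ω => (X n ω : ℝ)) (P n) -
        (TwoDimRec.Csigma i₀ j₀ t lam * (n : ℝ) + dσ)) =O[atTop] fun n : ℕ => γσ ^ n) ∧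
    TendstoInDistribution
      (fun (n : ℕ) (ω : Ω n) => ((X n ω : ℝ) - ∫ ω', (X n ω' : ℝ) ∂(P n)) /
        Real.sqrt (variance (fun ω' => (X n ω' : ℝ)) (P n)))
      atTop (id : ℝ → ℝ) P (gaussianReal 0 1) := by
  obtain ⟨m, rfl⟩ : ∃ m, i₀ = m + 1 := ⟨i₀ - 1, by omega⟩
  obtain ⟨D, hD⟩ := TwoDimRec.exists_row_support_bound hrec hp_zero hp_fin
  obtain ⟨L, hL, hL0, hLe, hm, hq⟩ := TwoDimRec.exists_log_root ht hT
  set v : ℕ → ℂ → ℂ := fun n s => ((lam : ℂ) ^ n)⁻¹ *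
    TwoDimRec.expPoly (fun k : ℕ => p n k) (D n) s * Complex.exp (-(n * L s)) with hv
  obtain ⟨K, γ, ε, hε, hγ0, hγ1, hvd, hgeom⟩ := TwoDimRec.exists_geometric_rescaled ht hT hrec
    hp_zero hD hL hL0 hLe (v := v) fun _ _ => rfl
  have hrow := TwoDimRec.rowSum_eq_sum_range hD
  have hnz : ¬ Tendsto (fun n => v n 0) atTop (nhds 0) := by
    intro h0
    -- The lower half of the `Θ` bound gives `lam ^ n = O(rowSum p n)`, and `v n 0` is `rowSum p n /
    -- lam ^ n`.
    have h1 : (fun _ : ℕ => (1 : ℝ)) =O[atTop] fun n => v n 0 := by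
      have h2 := (isBigO_refl (fun n : ℕ => (lam ^ n)⁻¹) atTop).mul hp_theta.2
      refine (h2.congr_left fun n => inv_mul_cancel₀ (pow_pos hT.1 n).ne').trans
        (IsBigO.of_bound 1 (.of_forall fun n => ?_))
      rw [one_mul, ← Complex.norm_real]
      simp only [hv, hL0, TwoDimRec.expPoly_zero, hrow]
      push_cast
      simp
    exact one_ne_zero (tendsto_nhds_unique tendsto_const_nhds (h1.trans_tendsto h0))
  obtain ⟨⟨dμ, hμ⟩, ⟨dσ, hσ⟩, hdist⟩ := TwoDimRec.quasiPower P X hX_meas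
    (fun n k => p n k) D (fun n k hk => hD n k (by exact_mod_cast hk))
    (fun n hn k => by rw [← hrow] at hn ⊢; exact hX n hn k)
    hL hL0 hm hq hC (fun _ _ => rfl) hε hγ0 hγ1 hvd hgeom hnz
  exact ⟨⟨dμ, γ, hγ0, hγ1, hμ⟩, ⟨dσ, γ, hγ0, hγ1, hσ⟩, hdist⟩
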